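/- Let $T=(\mathbb{C}^*)^k$ be a complex algebraic torus with Lie algebra $\mathfrak{t}=\mathbb{C}^k$, acting linearly on $V=\bigoplus_{i=1}^N V_i$, where each $V_i\simeq\mathbb{C}$ is one-dimensional with coordinate $v_i$ and $T$ acts on $V_i$ with weight $\rho_i\in\mathfrak{t}^\vee_{\mathbb{Z}}=\mathbb{Z}^k$. Let $\xi\in\mathfrak{t}^\vee_{\mathbb{Z}}$ be a character of $T$, defining a linearization whose invariant sections of $n$-th powers are the polynomials $f$ on $V$ with $f(t\cdot v)=\xi(t)^n f(v)$. Assume that $\xi$ is regular, i.e. $V^{\mathrm{sst}}=V^{\mathrm{st}}$ (every semistable point is stable, where stability includes finiteness of the stabilizer), and let $V/\!/T$ be the GIT quotient, which is then the geometric quotient $V^{\mathrm{sst}}/T$ with its Zariski topology. Let $R\in\mathbb{Z}^N$ and let $\mathbb{C}^*$ act on $V$ by $(s\cdot v)_i=s^{R_i}v_i$; this action commutes with $T$ and descends to $V/\!/T$. Write $V(v_i)\subseteq V/\!/T$ for the vanishing locus of the coordinate $v_i$. Put $f_i(u)=\rho_i(u)+R_i$ for $u\in\mathfrak{t}$ and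 $V(f_i)=\{u\in\mathfrak{t} : f_i(u)=0\}$. Let $\mathfrak{M}$ be the set of $P\in\mathfrak{t}$ such that $\bigcap_{i\in I}V(f_i)=\{P\}$ for some $I\subseteq\{1,\dots,N\}$. For $P\in\mathfrak{M}$ let $I_P=\{i : f_i(P)=0\}$ and $\mathcal{W}_P=\{\rho_i : i\in I_P\}$, and let $\mathfrak{M}^\xi=\{P\in\mathfrak{M} : \xi\in\mathrm{span}_{\mathbb{R}_{\ge 0}}(\mathcal{W}_P)\}$ be the set of stable isolated intersections. For $P\in\mathfrak{M}^\xi$ let $$\mathcal{B}_P=\bigcap_{j\notin I_P}V(v_j)\subseteq V/\!/T .$$ Then, for every $P\in\mathfrak{M}^\xi$, the inclusion of $V_P=\bigoplus_{i\in I_P}V_i$ into $V$ maps semistable points to semistable points and induces a homeomorphism (for the Zariski topologies) of $V_P/\!/T$, the quotient of $V_P$ with respect to $\xi$, onto $\mathcal{B}_P$. The map $P\mapsto\mathcal{B}_P$ is a bijection from $\mathfrak{M}^\xi$ onto the set of connected components of the fixed locus $(V/\!/T)^{\mathbb{C}^*}$. For a connected component $F$ let $I_F=\{i : F\nsubseteq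 V(v_i)\}$; then $\bigcap_{i\in I_F}V(f_i)$ consists of a single point, and the inverse bijection sends $F$ to that point. -/

import Mathlib

open scoped NNReal

noncomputable section

namespace TorusGIT

/-- The torus of rank `k` is `Fin k → ℂˣ`, its character lattice is `Fin k → ℤ`; this is the value
at `t` of the character `m`, i.e. the monomial `∏ l, t_l ^ m_l`. -/
def character {k : ℕ} (m : Fin k → ℤ) (t : Fin k → ℂˣ) : ℂˣ :=
  ∏ l, t l ^ m l

theorem character_mul {k : ℕ} (m : Fin k → ℤ) (s t : Fin k → ℂˣ) :
    character m (s * t) = character m s * character m t := by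
  simp [character, mul_zpow, Finset.prod_mul_distrib]

theorem character_one {k : ℕ} (m : Fin k → ℤ) : character m 1 = 1 := by
  simp [character]

/-- The diagonal action of the torus on `V = ι → ℂ` with weight `ρ i` on the `i`-th coordinate. -/
def torusAct {k : ℕ} {ι : Type*} (ρ : ι → Fin k → ℤ) (t : Fin k → ℂˣ) (v : ι → ℂ) : ι → ℂ :=
  fun i => (character (ρ i) t : ℂ) * v i

theorem torusAct_mul {k : ℕ} {ι : Type*} (ρ : ι → Fin k → ℤ) (s t : Fin k → ℂˣ) (v : ι → ℂ) :
    torusAct ρ (s * t) v = torusAct ρ s (torusAct ρ t v) := by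
  funext i
  simp [torusAct, character_mul, mul_assoc]

theorem torusAct_one {k : ℕ} {ι : Type*} (ρ : ι → Fin k → ℤ) (v : ι → ℂ) :
    torusAct ρ 1 v = v := by
  funext i
  simp [torusAct, character_one]

/-- The action of `ℂˣ` on `V` given by the R-charge `R`: `(s · v)_i = s ^ R_i * v_i`. -/
def chargeAct {ι : Type*} (R : ι → ℤ) (s : ℂˣ) (v : ι → ℂ) : ι → ℂ :=
  fun i => ((s ^ R i : ℂˣ) : ℂ) * v i

theorem chargeAct_mul {ι : Type*} (R : ι → ℤ) (s s' : ℂˣ) (v : ι → ℂ) :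
    chargeAct R (s * s') v = chargeAct R s (chargeAct R s' v) := by
  funext i
  simp [chargeAct, mul_zpow, mul_assoc]

theorem chargeAct_one {ι : Type*} (R : ι → ℤ) (v : ι → ℂ) : chargeAct R 1 v = v := by
  funext i
  simp [chargeAct]

theorem chargeAct_torusAct {k : ℕ} {ι : Type*} (ρ : ι → Fin k → ℤ) (R : ι → ℤ) (s : ℂˣ)
    (t : Fin k → ℂˣ) (v : ι → ℂ) :
    chargeAct R s (torusAct ρ t v) = torusAct ρ t (chargeAct R s v) := by
  funext i
  simp only [chargeAct, torusAct]
  ring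

/-- The Zariski topology on the affine space `ι → ℂ`: closed sets are the common zero sets of
families of polynomials. -/
@[reducible]
def zariskiTopology (ι : Type*) : TopologicalSpace (ι → ℂ) :=
  TopologicalSpace.ofClosed
    {Z | ∃ S : Set (MvPolynomial ι ℂ), Z = {v | ∀ f ∈ S, MvPolynomial.eval v f = 0}}
    ⟨{1}, by ext v; simp⟩
    (by
      intro A hA
      refine ⟨{f | ∃ S : Set (MvPolynomial ι ℂ),
        {v | ∀ g ∈ S, MvPolynomial.eval v g = 0} ∈ A ∧ f ∈ S}, ?_⟩
      ext v
      constructor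
      · rintro hv f ⟨S, hS, hf⟩
        exact hv _ hS f hf
      · intro hv Z hZ
        obtain ⟨S, rfl⟩ := hA hZ
        intro f hf
        exact hv f ⟨S, hZ, hf⟩)
    (by
      rintro _ ⟨S, rfl⟩ _ ⟨S', rfl⟩
      refine ⟨{f | ∃ g ∈ S, ∃ h ∈ S', f = g * h}, ?_⟩
      ext v
      constructor
      · rintro (hv | hv) _ ⟨g, hg, h, hh, rfl⟩
        · simp [hv g hg]
        · simp [hv h hh]
      · intro hv
        by_contra hcon
        simp only [Set.mem_union, Set.mem_ofPred_eq, not_or, not_forall] at hcon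
        obtain ⟨⟨g, hg, hg0⟩, h, hh, hh0⟩ := hcon
        have := hv (g * h) ⟨g, hg, h, hh, rfl⟩
        rw [map_mul] at this
        exact (mul_ne_zero hg0 hh0) this)

/-- Polynomials `f` on `V` with `f (t · v) = ξ(t) ^ n * f v`: the invariant sections of the `n`-th
power of the linearization given by the character `ξ`. -/
def IsSemiInvariant {k : ℕ} {ι : Type*} (ρ : ι → Fin k → ℤ) (ξ : Fin k → ℤ) (n : ℕ)
    (f : MvPolynomial ι ℂ) : Prop :=
  ∀ (t : Fin k → ℂˣ) (v : ι → ℂ),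
    MvPolynomial.eval (torusAct ρ t v) f = (character ξ t : ℂ) ^ n * MvPolynomial.eval v f

/-- Semistability: some invariant section of a positive power does not vanish at `v`. -/
def IsSemistable {k : ℕ} {ι : Type*} (ρ : ι → Fin k → ℤ) (ξ : Fin k → ℤ) (v : ι → ℂ) : Prop :=
  ∃ n : ℕ, 0 < n ∧ ∃ f : MvPolynomial ι ℂ, IsSemiInvariant ρ ξ n f ∧ MvPolynomial.eval v f ≠ 0

/-- The torus orbit of `v`. -/
def torusOrbit {k : ℕ} {ι : Type*} (ρ : ι → Fin k → ℤ) (v : ι → ℂ) : Set (ι → ℂ) :=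
  Set.range fun t : Fin k → ℂˣ => torusAct ρ t v

/-- (Proper) stability: some invariant section `f` of a positive power does not vanish at `v`, all
torus orbits in `V_f = {f ≠ 0}` are (Zariski) closed in `V_f`, and `v` has finite stabilizer. -/
def IsStable {k : ℕ} {ι : Type*} (ρ : ι → Fin k → ℤ) (ξ : Fin k → ℤ) (v : ι → ℂ) : Prop :=
  (∃ n : ℕ, 0 < n ∧ ∃ f : MvPolynomial ι ℂ, IsSemiInvariant ρ ξ n f ∧ MvPolynomial.eval v f ≠ 0 ∧
    ∀ w : ι → ℂ, MvPolynomial.eval w f ≠ 0 →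
      ∃ Z : Set (ι → ℂ), @IsClosed _ (zariskiTopology ι) Z ∧
        torusOrbit ρ w = Z ∩ {u | MvPolynomial.eval u f ≠ 0}) ∧
  {t : Fin k → ℂˣ | torusAct ρ t v = v}.Finite

/-- The linearization `ξ` is regular if all semistable points are stable (`V^sst = V^st`). -/
def IsRegular {k : ℕ} {ι : Type*} (ρ : ι → Fin k → ℤ) (ξ : Fin k → ℤ) : Prop :=
  {v : ι → ℂ | IsSemistable ρ ξ v} = {v | IsStable ρ ξ v}

theorem IsSemistable.chargeAct {k : ℕ} {ι : Type*} {ρ : ι → Fin k → ℤ} {ξ : Fin k → ℤ} (R : ι → ℤ)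
    (s : ℂˣ) {v : ι → ℂ} (hv : IsSemistable ρ ξ v) : IsSemistable ρ ξ (chargeAct R s v) := by
  obtain ⟨n, hn, f, hf, hfv⟩ := hv
  have key : ∀ w : ι → ℂ, MvPolynomial.eval w (MvPolynomial.bind₁ (fun i =>
      MvPolynomial.C (((s⁻¹) ^ R i : ℂˣ) : ℂ) * MvPolynomial.X i) f) =
      MvPolynomial.eval (TorusGIT.chargeAct R s⁻¹ w) f := by
    intro w
    rw [MvPolynomial.eval, MvPolynomial.eval₂Hom_bind₁]
    congr 2
    funext i
    simp [TorusGIT.chargeAct]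
  refine ⟨n, hn, MvPolynomial.bind₁ (fun i =>
    MvPolynomial.C (((s⁻¹) ^ R i : ℂˣ) : ℂ) * MvPolynomial.X i) f, fun t w => ?_, ?_⟩
  · rw [key, key, chargeAct_torusAct, hf]
  · rwa [key, ← chargeAct_mul, inv_mul_cancel, chargeAct_one]

/-- The semistable locus `V^sst`, with the Zariski topology induced from `V`. -/
structure SemistableLocus {k : ℕ} {ι : Type*} (ρ : ι → Fin k → ℤ) (ξ : Fin k → ℤ) where
  val : ι → ℂ
  property : IsSemistable ρ ξ val

instance {k : ℕ} {ι : Type*} (ρ : ι → Fin k → ℤ) (ξ : Fin k → ℤ) :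
    TopologicalSpace (SemistableLocus ρ ξ) :=
  TopologicalSpace.induced SemistableLocus.val (zariskiTopology ι)

/-- Two semistable points are equivalent if they lie in the same torus orbit. -/
def orbitSetoid {k : ℕ} {ι : Type*} (ρ : ι → Fin k → ℤ) (ξ : Fin k → ℤ) :
    Setoid (SemistableLocus ρ ξ) where
  r v w := ∃ t : Fin k → ℂˣ, torusAct ρ t v.val = w.val
  iseqv :=
    { refl := fun v => ⟨1, torusAct_one ρ v.val⟩
      symm := by
        rintro v w ⟨t, ht⟩
        exact ⟨t⁻¹, by rw [← ht, ← torusAct_mul, inv_mul_cancel, torusAct_one]⟩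
      trans := by
        rintro u v w ⟨t, ht⟩ ⟨t', ht'⟩
        exact ⟨t' * t, by rw [torusAct_mul, ht, ht']⟩ }

/-- The (closed points of the) quotient `V // T`. It is used for regular `ξ`, where the GIT quotient
is the geometric quotient of `V^sst = V^st`: its points are the torus orbits in `V^sst` and its
Zariski topology is the quotient topology. -/
def GITQuotient {k : ℕ} {ι : Type*} (ρ : ι → Fin k → ℤ) (ξ : Fin k → ℤ) : Type _ :=
  Quotient (orbitSetoid ρ ξ)

/-- The quotient map `V^sst → V // T`. -/
def GITQuotient.mk {k : ℕ} {ι : Type*} {ρ : ι → Fin k → ℤ} {ξ : Fin k → ℤ}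
    (v : SemistableLocus ρ ξ) : GITQuotient ρ ξ :=
  Quotient.mk (orbitSetoid ρ ξ) v

instance {k : ℕ} {ι : Type*} (ρ : ι → Fin k → ℤ) (ξ : Fin k → ℤ) :
    TopologicalSpace (GITQuotient ρ ξ) :=
  TopologicalSpace.coinduced GITQuotient.mk inferInstance

/-- The action of `s : ℂˣ` on `V // T` induced by the R-charge `R`. -/
def GITQuotient.act {k : ℕ} {ι : Type*} {ρ : ι → Fin k → ℤ} {ξ : Fin k → ℤ} (R : ι → ℤ) (s : ℂˣ) :
    GITQuotient ρ ξ → GITQuotient ρ ξ :=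
  Quotient.map (fun v => ⟨chargeAct R s v.val, v.property.chargeAct R s⟩) (by
    rintro v w ⟨t, ht⟩
    exact ⟨t, by simp only; rw [← chargeAct_torusAct, ht]⟩)

theorem GITQuotient.act_mk {k : ℕ} {ι : Type*} {ρ : ι → Fin k → ℤ} {ξ : Fin k → ℤ} (R : ι → ℤ)
    (s : ℂˣ) (v : SemistableLocus ρ ξ) :
    GITQuotient.act R s (GITQuotient.mk v) =
      GITQuotient.mk ⟨chargeAct R s v.val, v.property.chargeAct R s⟩ :=
  rfl

/-- The fixed locus `(V // T)^{ℂˣ}`. -/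
def fixedLocus {k : ℕ} {ι : Type*} (ρ : ι → Fin k → ℤ) (ξ : Fin k → ℤ) (R : ι → ℤ) :
    Set (GITQuotient ρ ξ) :=
  {x | ∀ s : ℂˣ, GITQuotient.act R s x = x}

/-- The set of connected components of `(V // T)^{ℂˣ}`, as subsets of `V // T`. -/
def fixedComponents {k : ℕ} {ι : Type*} (ρ : ι → Fin k → ℤ) (ξ : Fin k → ℤ) (R : ι → ℤ) :
    Set (Set (GITQuotient ρ ξ)) :=
  {F | ∃ x ∈ fixedLocus ρ ξ R, F = connectedComponentIn (fixedLocus ρ ξ R) x}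

/-- The affine function `f_i(u) = ρ_i(u) + R_i` on the Lie algebra `𝔱 = Fin k → ℂ`. -/
def affineFun {k : ℕ} {ι : Type*} (ρ : ι → Fin k → ℤ) (R : ι → ℤ) (i : ι) (u : Fin k → ℂ) : ℂ :=
  ∑ l, (ρ i l : ℂ) * u l + (R i : ℂ)

/-- The zero locus `V(f_i) ⊆ 𝔱`. -/
def hyperplane {k : ℕ} {ι : Type*} (ρ : ι → Fin k → ℤ) (R : ι → ℤ) (i : ι) : Set (Fin k → ℂ) :=
  {u | affineFun ρ R i u = 0}

/-- The set `𝔐` of isolated intersections of the hyperplanes `V(f_i)`. -/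
def isolatedIntersections {k : ℕ} {ι : Type*} (ρ : ι → Fin k → ℤ) (R : ι → ℤ) :
    Set (Fin k → ℂ) :=
  {P | ∃ I : Set ι, ⋂ i ∈ I, hyperplane ρ R i = {P}}

/-- `I_P`: the indices `i` with `f_i(P) = 0`. -/
def indexSet {k : ℕ} {ι : Type*} (ρ : ι → Fin k → ℤ) (R : ι → ℤ) (P : Fin k → ℂ) : Set ι :=
  {i | affineFun ρ R i P = 0}

/-- `𝒲_P = ρ(I_P)`, as a subset of the real dual Lie algebra `Fin k → ℝ`. -/
def weightSet {k : ℕ} {ι : Type*} (ρ : ι → Fin k → ℤ) (R : ι → ℤ) (P : Fin k → ℂ) :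
    Set (Fin k → ℝ) :=
  (fun i l => (ρ i l : ℝ)) '' indexSet ρ R P

/-- The set `𝔐^ξ` of stable isolated intersections: `ξ` is in the non-negative span of `𝒲_P`. -/
def stableIntersections {k : ℕ} {ι : Type*} (ρ : ι → Fin k → ℤ) (ξ : Fin k → ℤ) (R : ι → ℤ) :
    Set (Fin k → ℂ) :=
  {P | P ∈ isolatedIntersections ρ R ∧
    (fun l => (ξ l : ℝ)) ∈ Submodule.span ℝ≥0 (weightSet ρ R P)}

/-- The subvariety `V(v_j) ⊆ V // T` of classes of points whose `j`-th coordinate is zero. -/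
def coordLocus {k : ℕ} {ι : Type*} (ρ : ι → Fin k → ℤ) (ξ : Fin k → ℤ) (j : ι) :
    Set (GITQuotient ρ ξ) :=
  GITQuotient.mk '' {v | v.val j = 0}

/-- `𝓑_P`: the intersection in `V // T` of the loci `V(v_j)` over all `j ∉ I_P`. -/
def componentAt {k : ℕ} {ι : Type*} (ρ : ι → Fin k → ℤ) (ξ : Fin k → ℤ) (R : ι → ℤ)
    (P : Fin k → ℂ) : Set (GITQuotient ρ ξ) :=
  ⋂ j ∈ (indexSet ρ R P)ᶜ, coordLocus ρ ξ j

/-- `I_F`: the indices `i` such that `F` is not contained in `V(v_i)`. -/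
def componentIndexSet {k : ℕ} {ι : Type*} (ρ : ι → Fin k → ℤ) (ξ : Fin k → ℤ)
    (F : Set (GITQuotient ρ ξ)) : Set ι :=
  {i | ¬ F ⊆ coordLocus ρ ξ i}

/-- The weights of the subrepresentation of `V` spanned by the coordinates in `I`. -/
def restrictWeights {k : ℕ} {ι : Type*} (ρ : ι → Fin k → ℤ) (I : Set ι) : I → Fin k → ℤ :=
  fun i => ρ i

open Classical in
/-- The inclusion into `V` of the subspace spanned by the coordinates in `I` (extension by `0`). -/
def inclusion {ι : Type*} (I : Set ι) (v : I → ℂ) : ι → ℂ :=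
  fun i => if h : i ∈ I then v ⟨i, h⟩ else 0

end TorusGIT

end

noncomputable section

namespace TorusGIT

/-! A class `[v]` is fixed iff every `s · v` lies in the torus orbit of `v`. Taking `s = e` and
logarithms of absolute values produces a `P` with `f_i(P) = 0` on the support of `v`; conversely,
such a `P` exponentiates to torus elements realizing the action (`exists_affineFun_eq_zero`,
`exists_torusAct_eq_chargeAct`). By regularity `v` has finite stabilizer, so `P` is unique
(`eq_of_affineFun_eq_zero`). Semistability puts `ξ` in the cone of the weights on the support, so
`P` is a stable isolated intersection. Hence the fixed locus is the disjoint union of the `𝓑_P`,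
finite in number.

Each `𝓑_P` is the image of `V_P // T` under a closed embedding
(`GITQuotient.isClosedEmbedding_inclusion`). It is closed, and it is connected because a semistable
locus is irreducible. Finitely many disjoint closed connected pieces are the components, once they
are nonempty: as `ξ` lies in the cone of `𝒲_P`, the indicator vector of `I_P` is semistable. The
same point shows `I_F = I_P` for `F = 𝓑_P`. -/

/-! ### From real to integral solutions of linear systems -/

/-- Finitely many positive reals are simultaneously positive under some `ℚ`-linear functional. -/
theorem exists_rat_linear_pos (S : Finset ℝ) (hS : ∀ x ∈ S, 0 < x) :
    ∃ φ : ℝ →ₗ[ℚ] ℚ, ∀ x ∈ S, 0 < φ x := by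
  let W : Submodule ℚ ℝ := Submodule.span ℚ (S : Set ℝ)
  have : Module.Finite ℚ W := Module.Finite.span_finset ℚ S
  let b := Module.finBasis ℚ W
  -- The actual reals `b j` lie in the open set `U`, so by density it has a rational point; its
  -- coordinates are the values of `φ` on the basis.
  let U : Set (Fin (Module.finrank ℚ W) → ℝ) :=
    {c | ∀ x : S, 0 < ∑ j, (b.repr ⟨x, Submodule.subset_span x.2⟩ j : ℝ) * c j}
  have hU : IsOpen U := by
    simp only [U, Set.ofPred_forall]
    exact isOpen_iInter_of_finite fun x => isOpen_lt (by fun_prop) (by fun_prop)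
  have hne : U.Nonempty := by
    refine ⟨fun j => (b j : ℝ), fun x => ?_⟩
    have h := congrArg (fun w : W => (w : ℝ)) (b.sum_repr ⟨x, Submodule.subset_span x.2⟩)
    simp only [Submodule.coe_sum, Submodule.coe_smul, Rat.smul_def] at h
    rw [h]
    exact hS x x.2
  obtain ⟨q, hq⟩ := (DenseRange.piMap fun _ : Fin (Module.finrank ℚ W) =>
    Rat.denseRange_cast (𝕜 := ℝ)).exists_mem_open hU hne
  obtain ⟨φ, hφ⟩ := (b.constr ℚ q).exists_extend
  refine ⟨φ, fun x hx => ?_⟩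
  have h1 : φ x = b.constr ℚ q ⟨x, Submodule.subset_span hx⟩ := by rw [← hφ]; rfl
  rw [h1, Module.Basis.constr_apply_fintype]
  have h2 := hq ⟨x, hx⟩
  simp only [Pi.map_apply] at h2
  simp only [Module.Basis.equivFun_apply, smul_eq_mul]
  exact_mod_cast h2

theorem exists_nat_eq_mul_of_den_dvd {q : ℚ} (hq : 0 ≤ q) {D : ℕ} (h : q.den ∣ D) :
    ∃ m : ℕ, (m : ℚ) = q * D := by
  obtain ⟨e, rfl⟩ := h
  refine ⟨q.num.toNat * e, ?_⟩
  have h1 : ((q.num.toNat : ℤ) : ℚ) = q.num := by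
    rw [Int.toNat_of_nonneg (Rat.num_nonneg.mpr hq)]
  push_cast at h1 ⊢
  rw [h1, ← mul_assoc, Rat.mul_den_eq_num]

/-- A nonnegative real solution of an integral linear system yields a nonnegative integral solution
of a positive multiple of it, with smaller support. -/
theorem exists_nat_solution {ι κ : Type*} [Fintype ι] (a : ι → κ → ℤ) (b : κ → ℤ) (c : ι → ℝ)
    (hc : ∀ i, 0 ≤ c i) (h : ∀ l, ∑ i, c i * a i l = b l) :
    ∃ n : ℕ, 0 < n ∧ ∃ m : ι → ℕ, (∀ i, c i = 0 → m i = 0) ∧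
      ∀ l, ∑ i, (m i : ℤ) * a i l = n * b l := by
  classical
  -- Including `1` makes `φ 1` positive; after clearing denominators it becomes the multiplier `n`.
  obtain ⟨φ, hφ⟩ := exists_rat_linear_pos (insert 1 ((Finset.univ.image c).filter (0 < ·)))
    (by
      intro x hx
      rcases Finset.mem_insert.mp hx with rfl | hx
      · exact one_pos
      · exact (Finset.mem_filter.mp hx).2)
  have h1 : 0 < φ 1 := hφ 1 (Finset.mem_insert_self _ _)
  have hnonneg : ∀ i, 0 ≤ φ (c i) := by
    intro i
    rcases (hc i).eq_or_lt with h0 | h0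
    · simp [← h0]
    · exact (hφ _ (Finset.mem_insert_of_mem (by simp [h0]))).le
  have key : ∀ l, ∑ i, φ (c i) * a i l = φ 1 * b l := by
    intro l
    have := congrArg φ (h l)
    rw [map_sum] at this
    have e : ∀ (x : ℝ) (z : ℤ), φ (x * z) = φ x * z := by
      intro x z
      have : x * z = z • x := by simp [mul_comm]
      rw [this, map_zsmul]
      simp [mul_comm]
    simp only [e] at this
    rw [this, ← e, one_mul]
  let D : ℕ := (φ 1).den * ∏ i, (φ (c i)).den
  have hD : 0 < D := Nat.mul_pos (φ 1).den_pos (Finset.prod_pos fun i _ => (φ (c i)).den_pos)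
  obtain ⟨n, hn⟩ := exists_nat_eq_mul_of_den_dvd h1.le (Dvd.intro _ rfl : (φ 1).den ∣ D)
  have hm : ∀ i, ∃ m : ℕ, (m : ℚ) = φ (c i) * D := fun i =>
    exists_nat_eq_mul_of_den_dvd (hnonneg i)
      ((Finset.dvd_prod_of_mem (fun i => (φ (c i)).den) (Finset.mem_univ i)).mul_left _)
  choose m hm using hm
  have hD' : (0 : ℚ) < D := by exact_mod_cast hD
  refine ⟨n, ?_, m, fun i hi => ?_, fun l => ?_⟩
  · have : (0 : ℚ) < n := by rw [hn]; positivity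
    exact_mod_cast this
  · have := hm i
    rw [hi, map_zero, zero_mul] at this
    exact_mod_cast this
  · have : ∑ i, (m i : ℚ) * a i l = n * b l := by
      rw [hn, mul_right_comm, ← key l, Finset.sum_mul]
      exact Finset.sum_congr rfl fun i _ => by rw [hm]; ring
    exact_mod_cast this

/-! ### Semistability as a cone condition -/

theorem character_sum_mul {k : ℕ} {ι : Type*} [Fintype ι] (ρ : ι → Fin k → ℤ) (m : ι → ℕ)
    (t : Fin k → ℂˣ) :
    character (fun l => ∑ i, (m i : ℤ) * ρ i l) t = ∏ i, character (ρ i) t ^ m i := by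
  simp only [character, ← Finset.prod_pow]
  rw [Finset.prod_comm]
  refine Finset.prod_congr rfl fun l _ => ?_
  induction (Finset.univ : Finset ι) using Finset.cons_induction with
  | empty => simp
  | cons i s hi ih =>
    rw [Finset.sum_cons, Finset.prod_cons, zpow_add, ih, mul_comm (m i : ℤ), zpow_mul, zpow_natCast]

theorem character_natCast_mul {k : ℕ} (n : ℕ) (ξ : Fin k → ℤ) (t : Fin k → ℂˣ) :
    character (fun l => (n : ℤ) * ξ l) t = character ξ t ^ n := by
  simpa using character_sum_mul (fun _ : Unit => ξ) (fun _ => n) t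

theorem character_injective {k : ℕ} {a b : Fin k → ℤ} (h : ∀ t, character a t = character b t) :
    a = b := by
  classical
  funext l
  have h2 : (2 : ℂ) ≠ 0 := two_ne_zero
  have := congrArg (fun u : ℂˣ => ‖(u : ℂ)‖) (h (Pi.mulSingle l (Units.mk0 2 h2)))
  have e : ∀ m : Fin k → ℤ,
      ‖(character m (Pi.mulSingle l (Units.mk0 2 h2)) : ℂ)‖ = (2 : ℝ) ^ m l := by
    intro m
    rw [character, Finset.prod_eq_single l (fun j _ hj => by simp [Pi.mulSingle_eq_of_ne hj])
      (by simp)]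
    simp
  simp only [e] at this
  exact zpow_right_injective₀ two_pos (by norm_num) this

/-- Writing `f(t · v)` as a polynomial in `v` allows semi-invariance to be tested coefficient by
coefficient. -/
theorem eval_torusAct {k : ℕ} {ι : Type*} (ρ : ι → Fin k → ℤ) (t : Fin k → ℂˣ) (v : ι → ℂ)
    (f : MvPolynomial ι ℂ) :
    MvPolynomial.eval (torusAct ρ t v) f = MvPolynomial.eval v (∑ m ∈ f.support,
      MvPolynomial.monomial m (f.coeff m * m.prod fun i e => (character (ρ i) t : ℂ) ^ e)) := by
  conv_lhs => rw [f.as_sum]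
  rw [map_sum, map_sum]
  refine Finset.sum_congr rfl fun m _ => ?_
  simp only [MvPolynomial.eval_monomial, torusAct, mul_pow, Finsupp.prod_mul]
  rw [← mul_assoc]

/-- Every monomial of a semi-invariant polynomial has weight `n ξ`. -/
theorem IsSemiInvariant.weight_eq {k : ℕ} {ι : Type*} [Fintype ι] {ρ : ι → Fin k → ℤ}
    {ξ : Fin k → ℤ} {n : ℕ} {f : MvPolynomial ι ℂ} (hf : IsSemiInvariant ρ ξ n f) {m : ι →₀ ℕ}
    (hm : MvPolynomial.coeff m f ≠ 0) (l : Fin k) :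
    ∑ i, (m i : ℤ) * ρ i l = n * ξ l := by
  classical
  refine congrFun (character_injective (a := fun l => ∑ i, (m i : ℤ) * ρ i l)
    (b := fun l => (n : ℤ) * ξ l) fun t => ?_) l
  have h : (∑ m ∈ f.support,
      MvPolynomial.monomial m (f.coeff m * m.prod fun i e => (character (ρ i) t : ℂ) ^ e)) =
      MvPolynomial.C ((character ξ t : ℂ) ^ n) * f := by
    refine MvPolynomial.funext fun v => ?_
    rw [← eval_torusAct, hf t v, map_mul, MvPolynomial.eval_C]
  have h := congrArg (MvPolynomial.coeff m) h
  rw [MvPolynomial.coeff_C_mul, MvPolynomial.coeff_sum] at h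
  simp only [MvPolynomial.coeff_monomial] at h
  rw [Finset.sum_ite_eq' f.support m, if_pos (MvPolynomial.mem_support_iff.mpr hm)] at h
  rw [mul_comm] at h
  have h := mul_right_cancel₀ hm h
  rw [character_sum_mul, character_natCast_mul]
  refine Units.ext ?_
  rw [Finsupp.prod_fintype _ _ (by simp)] at h
  push_cast
  exact h

/-- A semi-invariant that is nonzero at `v` has a monomial that is nonzero at `v`, and this monomial
is itself semi-invariant of the same weight. -/
theorem isSemistable_iff {k : ℕ} {ι : Type*} [Fintype ι] {ρ : ι → Fin k → ℤ} {ξ : Fin k → ℤ}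
    {v : ι → ℂ} :
    IsSemistable ρ ξ v ↔ ∃ n : ℕ, 0 < n ∧ ∃ m : ι → ℕ, (∀ i, v i = 0 → m i = 0) ∧
      ∀ l, ∑ i, (m i : ℤ) * ρ i l = n * ξ l := by
  constructor
  · rintro ⟨n, hn, f, hf, hfv⟩
    rw [MvPolynomial.eval_eq'] at hfv
    obtain ⟨m, hm, hne⟩ := Finset.exists_ne_zero_of_sum_ne_zero hfv
    refine ⟨n, hn, m, fun i hi => ?_, hf.weight_eq (MvPolynomial.mem_support_iff.mp hm)⟩
    by_contra h0
    exact hne (by rw [Finset.prod_eq_zero (Finset.mem_univ i) (by rw [hi, zero_pow h0]), mul_zero])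
  · rintro ⟨n, hn, m, hm, h⟩
    refine ⟨n, hn, ∏ i, MvPolynomial.X i ^ m i, fun t w => ?_, ?_⟩
    · have := character_sum_mul ρ m t
      rw [funext h, character_natCast_mul] at this
      have := congrArg (fun u : ℂˣ => (u : ℂ)) this
      push_cast at this
      simp [torusAct, mul_pow, Finset.prod_mul_distrib, this]
    · simp only [map_prod, map_pow, MvPolynomial.eval_X]
      refine Finset.prod_ne_zero_iff.mpr fun i _ => ?_
      by_cases hi : v i = 0
      · simp [hm i hi]
      · exact pow_ne_zero _ hi

theorem IsSemistable.mem_span {k : ℕ} {ι : Type*} [Fintype ι] {ρ : ι → Fin k → ℤ} {ξ : Fin k → ℤ}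
    {v : ι → ℂ} (hv : IsSemistable ρ ξ v) {I : Set ι} (hI : ∀ i, v i ≠ 0 → i ∈ I) :
    (fun l => (ξ l : ℝ)) ∈ Submodule.span ℝ≥0 ((fun i l => (ρ i l : ℝ)) '' I) := by
  obtain ⟨n, hn, m, hm, h⟩ := isSemistable_iff.mp hv
  have e : (fun l => (ξ l : ℝ)) = ∑ i, ((m i : ℝ≥0) / n) • (fun l => (ρ i l : ℝ)) := by
    funext l
    have hn' : (n : ℝ) ≠ 0 := by positivity
    have h' : ∑ i, (m i : ℝ) * ρ i l = n * ξ l := by exact_mod_cast h l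
    simp only [Finset.sum_apply, Pi.smul_apply, NNReal.smul_def, smul_eq_mul]
    push_cast
    rw [eq_comm, ← mul_right_inj' hn', ← h', Finset.mul_sum]
    exact Finset.sum_congr rfl fun i _ => by field_simp
  rw [e]
  refine Submodule.sum_mem _ fun i _ => ?_
  by_cases hi : v i = 0
  · simp [hm i hi]
  · exact Submodule.smul_mem _ _ (Submodule.subset_span ⟨i, hI i hi, rfl⟩)

/-- Real cone coefficients become integer exponents without enlarging the support, by
`exists_nat_solution`. Here `I` is contained in the support of `v`, whereas in
`IsSemistable.mem_span` it contains it. -/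
theorem isSemistable_of_mem_span {k : ℕ} {ι : Type*} [Fintype ι] {ρ : ι → Fin k → ℤ}
    {ξ : Fin k → ℤ} {I : Set ι}
    (h : (fun l => (ξ l : ℝ)) ∈ Submodule.span ℝ≥0 ((fun i l => (ρ i l : ℝ)) '' I))
    {v : ι → ℂ} (hv : ∀ i ∈ I, v i ≠ 0) : IsSemistable ρ ξ v := by
  obtain ⟨c, hc, h⟩ := (Finsupp.mem_span_image_iff_linearCombination ℝ≥0).mp h
  obtain ⟨n, hn, m, hm, hmn⟩ := exists_nat_solution ρ ξ (fun i => (c i : ℝ)) (fun i => (c i).2)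
    (fun l => by
      have := congrFun h l
      rw [Finsupp.linearCombination_apply, Finsupp.sum_fintype _ _ (by simp)] at this
      simpa [NNReal.smul_def] using this)
  refine isSemistable_iff.mpr ⟨n, hn, m, fun i hi => hm i ?_, hmn⟩
  by_contra h0
  exact hv i ((Finsupp.mem_supported _ _).mp hc (Finsupp.mem_support_iff.mpr (by simpa using h0))) hi

/-! ### Fixed points and zeros of the affine functions -/

/-- The one-parameter family `exp (c u)` in the torus with Lie algebra direction `u`. -/
def expTorus {k : ℕ} (u : Fin k → ℂ) (c : ℂ) : Fin k → ℂˣ :=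
  fun l => Units.mk0 (Complex.exp (c * u l)) (Complex.exp_ne_zero _)

theorem character_expTorus {k : ℕ} (m : Fin k → ℤ) (u : Fin k → ℂ) (c : ℂ) :
    (character m (expTorus u c) : ℂ) = Complex.exp (c * ∑ l, (m l : ℂ) * u l) := by
  simp only [character, expTorus, Units.coe_prod, Units.val_zpow_eq_zpow_val, Units.val_mk0,
    ← Complex.exp_int_mul, ← Complex.exp_sum, Finset.mul_sum]
  congr 1
  exact Finset.sum_congr rfl fun l _ => by ring

/-- If `v` has finite stabilizer, the weights of its nonzero coordinates have no common kernel. -/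
theorem eq_zero_of_finite_stabilizer {k : ℕ} {ι : Type*} {ρ : ι → Fin k → ℤ} {v : ι → ℂ}
    (hv : {t : Fin k → ℂˣ | torusAct ρ t v = v}.Finite) {u : Fin k → ℂ}
    (hu : ∀ i, v i ≠ 0 → ∑ l, (ρ i l : ℂ) * u l = 0) : u = 0 := by
  by_contra hne
  obtain ⟨l, hl⟩ := Function.ne_iff.mp hne
  have hl : u l ≠ 0 := hl
  -- Dividing by `u l` makes the `l`-th coordinate equal to `exp x`, whose norm separates real `x`.
  refine Set.infinite_of_injective_forall_mem (f := fun x : ℝ => expTorus u ((x : ℂ) / u l))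
    (fun x y hxy => ?_) (fun x => ?_) hv
  · have h := congrArg (fun u : ℂˣ => ‖(u : ℂ)‖) (congrFun hxy l)
    simpa [expTorus, div_mul_cancel₀ _ hl, Complex.norm_exp] using h
  · change torusAct ρ _ v = v
    funext i
    by_cases hi : v i = 0
    · simp [torusAct, hi]
    · simp [torusAct, character_expTorus, hu i hi]

/-- The difference `P - Q` is killed by all weights on the support of `v`, hence vanishes by
finiteness of the stabilizer. This is where regularity enters. -/
theorem eq_of_affineFun_eq_zero {k : ℕ} {ι : Type*} {ρ : ι → Fin k → ℤ} {ξ : Fin k → ℤ}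
    (hξ : IsRegular ρ ξ) {R : ι → ℤ} {v : ι → ℂ} (hv : IsSemistable ρ ξ v) {P Q : Fin k → ℂ}
    (hP : ∀ i, v i ≠ 0 → affineFun ρ R i P = 0) (hQ : ∀ i, v i ≠ 0 → affineFun ρ R i Q = 0) :
    P = Q := by
  have hst : IsStable ρ ξ v := (Set.ext_iff.mp hξ v).mp hv
  refine sub_eq_zero.mp (eq_zero_of_finite_stabilizer hst.2 fun i hi => ?_)
  have h := congrArg₂ (· - ·) (hP i hi) (hQ i hi)
  simp only [affineFun] at h
  simp only [Pi.sub_apply, mul_sub, Finset.sum_sub_distrib]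
  linear_combination h

theorem exists_affineFun_eq_zero {k : ℕ} {ι : Type*} {ρ : ι → Fin k → ℤ} {R : ι → ℤ} {v : ι → ℂ}
    (h : ∀ s : ℂˣ, ∃ t, torusAct ρ t v = chargeAct R s v) :
    ∃ P : Fin k → ℂ, ∀ i, v i ≠ 0 → affineFun ρ R i P = 0 := by
  -- The single element `s = e` suffices: taking `log` of norms in `ρ_i(t) = e ^ R_i` gives `ρ_i(log
  -- |t|) = R_i`, so `P = -log |t|`.
  obtain ⟨t, ht⟩ := h (Units.mk0 (Complex.exp 1) (Complex.exp_ne_zero _))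
  refine ⟨fun l => -(Real.log ‖(t l : ℂ)‖ : ℝ), fun i hi => ?_⟩
  have h := mul_right_cancel₀ hi (congrFun ht i)
  have h := congrArg (fun z : ℂ => Real.log ‖z‖) h
  have e : Real.log ‖(character (ρ i) t : ℂ)‖ = ∑ l, (ρ i l : ℝ) * Real.log ‖(t l : ℂ)‖ := by
    rw [character, Units.coe_prod, norm_prod,
      Real.log_prod (fun l _ => norm_ne_zero_iff.mpr (Units.ne_zero _))]
    simp
  simp only [e, Units.val_zpow_eq_zpow_val, norm_zpow, Real.log_zpow, Units.val_mk0,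
    Complex.norm_exp, Real.log_exp, Complex.one_re, mul_one] at h
  simp only [affineFun, mul_neg, Finset.sum_neg_distrib]
  rw [neg_add_eq_zero]
  exact_mod_cast h

/-- If `s = exp c`, then `exp (-c P)` scales each nonzero coordinate by `exp (-c ρ_i(P)) = exp (c
R_i) = s ^ R_i`. -/
theorem exists_torusAct_eq_chargeAct {k : ℕ} {ι : Type*} {ρ : ι → Fin k → ℤ} {R : ι → ℤ}
    {v : ι → ℂ} {P : Fin k → ℂ} (hP : ∀ i, v i ≠ 0 → affineFun ρ R i P = 0) (s : ℂˣ) :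
    ∃ t, torusAct ρ t v = chargeAct R s v := by
  obtain ⟨c, hc⟩ : ∃ c, Complex.exp c = s := ⟨Complex.log s, Complex.exp_log s.ne_zero⟩
  refine ⟨expTorus P (-c), funext fun i => ?_⟩
  by_cases hi : v i = 0
  · simp [torusAct, chargeAct, hi]
  · have h := hP i hi
    rw [affineFun] at h
    simp only [torusAct, chargeAct, character_expTorus, Units.val_zpow_eq_zpow_val, ← hc,
      ← Complex.exp_int_mul, eq_neg_of_add_eq_zero_left h]
    ring_nf

/-! ### Zariski topology and irreducibility of the semistable locus -/

theorem SemistableLocus.ext {k : ℕ} {ι : Type*} {ρ : ι → Fin k → ℤ} {ξ : Fin k → ℤ}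
    {v w : SemistableLocus ρ ξ} (h : v.val = w.val) : v = w := by
  cases v; cases w; cases h; rfl

theorem isClosed_zariskiTopology_iff {ι : Type*} {Z : Set (ι → ℂ)} :
    @IsClosed _ (zariskiTopology ι) Z ↔
      ∃ S : Set (MvPolynomial ι ℂ), Z = {v | ∀ f ∈ S, MvPolynomial.eval v f = 0} := by
  rw [← @isOpen_compl_iff _ _ (zariskiTopology ι)]
  change Zᶜᶜ ∈ _ ↔ _
  rw [compl_compl]
  rfl

theorem SemistableLocus.isClosed_iff {k : ℕ} {ι : Type*} {ρ : ι → Fin k → ℤ} {ξ : Fin k → ℤ}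
    {Z : Set (SemistableLocus ρ ξ)} :
    IsClosed Z ↔
      ∃ S : Set (MvPolynomial ι ℂ), Z = {v | ∀ f ∈ S, MvPolynomial.eval v.val f = 0} := by
  let := zariskiTopology ι
  rw [isClosed_induced_iff]
  constructor
  · rintro ⟨_, hZ, rfl⟩
    obtain ⟨S, rfl⟩ := isClosed_zariskiTopology_iff.mp hZ
    exact ⟨S, rfl⟩
  · rintro ⟨S, rfl⟩
    exact ⟨_, isClosed_zariskiTopology_iff.mpr ⟨S, rfl⟩, rfl⟩

theorem GITQuotient.isClosed_iff {k : ℕ} {ι : Type*} {ρ : ι → Fin k → ℤ} {ξ : Fin k → ℤ}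
    {Z : Set (GITQuotient ρ ξ)} : IsClosed Z ↔ IsClosed (GITQuotient.mk ⁻¹' Z) :=
  isClosed_coinduced

theorem GITQuotient.continuous_mk {k : ℕ} {ι : Type*} {ρ : ι → Fin k → ℤ} {ξ : Fin k → ℤ} :
    Continuous (GITQuotient.mk : SemistableLocus ρ ξ → GITQuotient ρ ξ) :=
  continuous_coinduced_rng

theorem GITQuotient.mk_surjective {k : ℕ} {ι : Type*} {ρ : ι → Fin k → ℤ} {ξ : Fin k → ℤ} :
    Function.Surjective (GITQuotient.mk : SemistableLocus ρ ξ → GITQuotient ρ ξ) :=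
  Quotient.mk_surjective

theorem GITQuotient.mk_eq_mk {k : ℕ} {ι : Type*} {ρ : ι → Fin k → ℤ} {ξ : Fin k → ℤ}
    {v w : SemistableLocus ρ ξ} :
    GITQuotient.mk v = GITQuotient.mk w ↔ ∃ t, torusAct ρ t v.val = w.val :=
  Quotient.eq (r := orbitSetoid ρ ξ)

theorem exists_eval_ne_zero_of_isOpen {k : ℕ} {ι : Type*} {ρ : ι → Fin k → ℤ} {ξ : Fin k → ℤ}
    {U : Set (SemistableLocus ρ ξ)} (hU : IsOpen U) {a : SemistableLocus ρ ξ} (ha : a ∈ U) :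
    ∃ f : MvPolynomial ι ℂ, MvPolynomial.eval a.val f ≠ 0 ∧
      ∀ b : SemistableLocus ρ ξ, MvPolynomial.eval b.val f ≠ 0 → b ∈ U := by
  obtain ⟨S, hS⟩ := SemistableLocus.isClosed_iff.mp hU.isClosed_compl
  have ha' : a ∉ Uᶜ := fun h => h ha
  rw [hS] at ha'
  obtain ⟨f, hf, hfa⟩ : ∃ f ∈ S, MvPolynomial.eval a.val f ≠ 0 := by
    by_contra! h
    exact ha' h
  refine ⟨f, hfa, fun b hb => ?_⟩
  by_contra hbU
  have hb' : b ∈ Uᶜ := hbU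
  rw [hS] at hb'
  exact hb (hb' f hf)

/-- Two nonempty open sets contain loci where polynomials `f`, `g` do not vanish. Multiplying by a
semi-invariant `h` keeps a common nonvanishing point semistable; one exists because `f * g * h` is a
nonzero polynomial over an infinite field. -/
instance {k : ℕ} {ι : Type*} (ρ : ι → Fin k → ℤ) (ξ : Fin k → ℤ) :
    PreirreducibleSpace (SemistableLocus ρ ξ) where
  isPreirreducible_univ := by
    rintro U U' hU hU' ⟨a, -, ha⟩ ⟨b, -, hb⟩
    obtain ⟨f, hfa, hf⟩ := exists_eval_ne_zero_of_isOpen hU ha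
    obtain ⟨g, hgb, hg⟩ := exists_eval_ne_zero_of_isOpen hU' hb
    obtain ⟨n, hn, h, hh, hha⟩ := a.property
    have hne : f * g * h ≠ 0 := by
      refine mul_ne_zero (mul_ne_zero ?_ ?_) ?_ <;> rintro rfl <;> simp_all
    obtain ⟨x, hx⟩ : ∃ x, MvPolynomial.eval x (f * g * h) ≠ 0 := by
      by_contra! hzero
      exact hne (MvPolynomial.funext fun x => by rw [hzero x, map_zero])
    rw [map_mul, map_mul] at hx
    have hx1 := left_ne_zero_of_mul hx
    let y : SemistableLocus ρ ξ := ⟨x, n, hn, h, hh, right_ne_zero_of_mul hx⟩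
    exact ⟨y, trivial, hf y (left_ne_zero_of_mul hx1), hg y (right_ne_zero_of_mul hx1)⟩

instance {k : ℕ} {ι : Type*} (ρ : ι → Fin k → ℤ) (ξ : Fin k → ℤ) :
    PreconnectedSpace (GITQuotient ρ ξ) :=
  GITQuotient.mk_surjective.denseRange.preconnectedSpace GITQuotient.continuous_mk

/-! ### The closed embedding of the quotient of a coordinate subspace -/

theorem inclusion_comp_val {ι : Type*} (I : Set ι) (v : I → ℂ) :
    inclusion I v ∘ Subtype.val = v := by
  funext i
  simp [inclusion]

theorem inclusion_of_notMem {ι : Type*} {I : Set ι} (v : I → ℂ) {i : ι} (hi : i ∉ I) :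
    inclusion I v i = 0 :=
  dif_neg hi

theorem inclusion_restrict {ι : Type*} {I : Set ι} {w : ι → ℂ} (hw : ∀ i ∉ I, w i = 0) :
    inclusion I (w ∘ Subtype.val) = w := by
  funext i
  by_cases hi : i ∈ I
  · simp [inclusion, hi]
  · rw [inclusion_of_notMem _ hi, hw i hi]

theorem inclusion_torusAct {k : ℕ} {ι : Type*} (ρ : ι → Fin k → ℤ) (I : Set ι) (t : Fin k → ℂˣ)
    (v : I → ℂ) :
    inclusion I (torusAct (restrictWeights ρ I) t v) = torusAct ρ t (inclusion I v) := by
  funext i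
  by_cases hi : i ∈ I <;> simp [inclusion, torusAct, restrictWeights, hi]

open Classical in
theorem exists_eval_eq_eval_inclusion {ι : Type*} (I : Set ι) (f : MvPolynomial ι ℂ) :
    ∃ g : MvPolynomial I ℂ, ∀ v, MvPolynomial.eval v g = MvPolynomial.eval (inclusion I v) f := by
  refine ⟨MvPolynomial.bind₁ (fun i => if h : i ∈ I then MvPolynomial.X ⟨i, h⟩ else 0) f,
    fun v => ?_⟩
  rw [MvPolynomial.eval, MvPolynomial.eval₂Hom_bind₁]
  congr 2
  funext i
  by_cases hi : i ∈ I <;> simp [inclusion, hi]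

/-- Semi-invariants pull back along the equivariant coordinate projection `V → V_I`; the converse
`IsSemistable.restrict` restricts them to `V_I`. -/
theorem IsSemistable.inclusion {k : ℕ} {ι : Type*} {ρ : ι → Fin k → ℤ} {ξ : Fin k → ℤ} {I : Set ι}
    {v : I → ℂ} (hv : IsSemistable (restrictWeights ρ I) ξ v) :
    IsSemistable ρ ξ (inclusion I v) := by
  obtain ⟨n, hn, f, hf, hfv⟩ := hv
  refine ⟨n, hn, MvPolynomial.rename Subtype.val f, fun t w => ?_, ?_⟩
  · rw [MvPolynomial.eval_rename, MvPolynomial.eval_rename]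
    exact hf t (w ∘ Subtype.val)
  · rwa [MvPolynomial.eval_rename, inclusion_comp_val]

theorem IsSemistable.restrict {k : ℕ} {ι : Type*} {ρ : ι → Fin k → ℤ} {ξ : Fin k → ℤ} {I : Set ι}
    {w : ι → ℂ} (hw : IsSemistable ρ ξ w) (h0 : ∀ i ∉ I, w i = 0) :
    IsSemistable (restrictWeights ρ I) ξ (w ∘ Subtype.val) := by
  obtain ⟨n, hn, f, hf, hfw⟩ := hw
  obtain ⟨g, hg⟩ := exists_eval_eq_eval_inclusion I f
  refine ⟨n, hn, g, fun t v => ?_, ?_⟩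
  · rw [hg, hg, inclusion_torusAct, hf]
  · rwa [hg, inclusion_restrict h0]

/-- The inclusion `V_I^sst → V^sst`. -/
def SemistableLocus.inclusion {k : ℕ} {ι : Type*} {ρ : ι → Fin k → ℤ} {ξ : Fin k → ℤ} (I : Set ι)
    (v : SemistableLocus (restrictWeights ρ I) ξ) : SemistableLocus ρ ξ :=
  ⟨TorusGIT.inclusion I v.val, v.property.inclusion⟩

theorem SemistableLocus.continuous_inclusion {k : ℕ} {ι : Type*} {ρ : ι → Fin k → ℤ}
    {ξ : Fin k → ℤ} (I : Set ι) :
    Continuous (SemistableLocus.inclusion I :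
      SemistableLocus (restrictWeights ρ I) ξ → SemistableLocus ρ ξ) := by
  refine continuous_iff_isClosed.mpr fun Z hZ => ?_
  obtain ⟨S, rfl⟩ := SemistableLocus.isClosed_iff.mp hZ
  choose g hg using exists_eval_eq_eval_inclusion I
  refine SemistableLocus.isClosed_iff.mpr ⟨g '' S, ?_⟩
  ext v
  simp [hg, SemistableLocus.inclusion]

/-- The map `V_I // T → V // T` induced by the inclusion of `V_I` into `V`. -/
def GITQuotient.inclusion {k : ℕ} {ι : Type*} (ρ : ι → Fin k → ℤ) (ξ : Fin k → ℤ) (I : Set ι) :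
    GITQuotient (restrictWeights ρ I) ξ → GITQuotient ρ ξ :=
  Quotient.map (SemistableLocus.inclusion I) (by
    rintro v w ⟨t, ht⟩
    exact ⟨t, by rw [SemistableLocus.inclusion, ← inclusion_torusAct, ht]; rfl⟩)

theorem GITQuotient.inclusion_mk {k : ℕ} {ι : Type*} {ρ : ι → Fin k → ℤ} {ξ : Fin k → ℤ}
    (I : Set ι) (v : SemistableLocus (restrictWeights ρ I) ξ) :
    GITQuotient.inclusion ρ ξ I (GITQuotient.mk v) =
      GITQuotient.mk (SemistableLocus.inclusion I v) :=
  rfl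

theorem GITQuotient.inclusion_injective {k : ℕ} {ι : Type*} (ρ : ι → Fin k → ℤ) (ξ : Fin k → ℤ)
    (I : Set ι) : Function.Injective (GITQuotient.inclusion ρ ξ I) := by
  intro x y hxy
  obtain ⟨v, rfl⟩ := GITQuotient.mk_surjective x
  obtain ⟨w, rfl⟩ := GITQuotient.mk_surjective y
  rw [inclusion_mk, inclusion_mk, mk_eq_mk] at hxy
  obtain ⟨t, ht⟩ := hxy
  refine mk_eq_mk.mpr ⟨t, ?_⟩
  have h : TorusGIT.inclusion I _ = TorusGIT.inclusion I _ :=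
    (inclusion_torusAct ρ I t v.val).trans ht
  rw [← inclusion_comp_val I (torusAct _ t v.val), h, inclusion_comp_val]

theorem torusAct_eq_zero_iff {k : ℕ} {ι : Type*} {ρ : ι → Fin k → ℤ} {t : Fin k → ℂˣ} {v : ι → ℂ}
    {i : ι} : torusAct ρ t v i = 0 ↔ v i = 0 := by
  simp [torusAct]

/-- Vanishing of a coordinate is constant on torus orbits, so membership can be tested on any
representative. -/
theorem mk_mem_coordLocus {k : ℕ} {ι : Type*} {ρ : ι → Fin k → ℤ} {ξ : Fin k → ℤ} {j : ι}
    {v : SemistableLocus ρ ξ} : GITQuotient.mk v ∈ coordLocus ρ ξ j ↔ v.val j = 0 := by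
  refine ⟨?_, fun h => ⟨v, h, rfl⟩⟩
  rintro ⟨w, hw, h⟩
  obtain ⟨t, ht⟩ := GITQuotient.mk_eq_mk.mp h
  rw [← ht, torusAct_eq_zero_iff]
  exact hw

theorem mk_mem_iInter_coordLocus {k : ℕ} {ι : Type*} {ρ : ι → Fin k → ℤ} {ξ : Fin k → ℤ}
    {I : Set ι} {v : SemistableLocus ρ ξ} :
    GITQuotient.mk v ∈ ⋂ j ∈ Iᶜ, coordLocus ρ ξ j ↔ ∀ j ∉ I, v.val j = 0 := by
  simp [mk_mem_coordLocus]

theorem GITQuotient.range_inclusion {k : ℕ} {ι : Type*} (ρ : ι → Fin k → ℤ) (ξ : Fin k → ℤ)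
    (I : Set ι) :
    Set.range (GITQuotient.inclusion ρ ξ I) = ⋂ j ∈ Iᶜ, coordLocus ρ ξ j := by
  ext x
  constructor
  · rintro ⟨y, rfl⟩
    obtain ⟨v, rfl⟩ := GITQuotient.mk_surjective y
    rw [inclusion_mk, mk_mem_iInter_coordLocus]
    exact fun j hj => inclusion_of_notMem _ hj
  · obtain ⟨w, rfl⟩ := GITQuotient.mk_surjective x
    intro hw
    have h0 := mk_mem_iInter_coordLocus.mp hw
    refine ⟨GITQuotient.mk ⟨w.val ∘ Subtype.val, w.property.restrict h0⟩, ?_⟩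
    rw [inclusion_mk]
    exact congrArg _ (SemistableLocus.ext (inclusion_restrict h0))

theorem GITQuotient.isClosedEmbedding_inclusion {k : ℕ} {ι : Type*} (ρ : ι → Fin k → ℤ)
    (ξ : Fin k → ℤ) (I : Set ι) :
    Topology.IsClosedEmbedding (GITQuotient.inclusion ρ ξ I) := by
  refine .of_continuous_injective_isClosedMap ?_ (inclusion_injective ρ ξ I) fun C hC => ?_
  · exact continuous_coinduced_dom.mpr
      (GITQuotient.continuous_mk.comp (SemistableLocus.continuous_inclusion I))
  · rw [GITQuotient.isClosed_iff] at hC ⊢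
    obtain ⟨S, hS⟩ := SemistableLocus.isClosed_iff.mp hC
    have hS' : ∀ v, GITQuotient.mk v ∈ C ↔ ∀ f ∈ S, MvPolynomial.eval v.val f = 0 :=
      fun v => Set.ext_iff.mp hS v
    -- The image is cut out by the coordinates outside `I` together with the equations of `C`, read
    -- as polynomials on `V`.
    refine SemistableLocus.isClosed_iff.mpr
      ⟨MvPolynomial.X '' Iᶜ ∪ MvPolynomial.rename Subtype.val '' S, ?_⟩
    ext w
    have hw : (∀ f ∈ MvPolynomial.X '' Iᶜ ∪ MvPolynomial.rename Subtype.val '' S,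
        MvPolynomial.eval w.val f = 0) ↔ (∀ i ∉ I, w.val i = 0) ∧
          ∀ f ∈ S, MvPolynomial.eval (w.val ∘ Subtype.val) f = 0 := by
      simp [or_imp, forall_and, MvPolynomial.eval_rename]
    refine Iff.trans ?_ hw.symm
    constructor
    · intro hwC
      have h0 := mk_mem_iInter_coordLocus.mp
        (range_inclusion ρ ξ I ▸ Set.image_subset_range _ _ hwC)
      refine ⟨h0, (hS' ⟨_, w.property.restrict h0⟩).mp ?_⟩
      rw [← (inclusion_injective ρ ξ I).mem_set_image, inclusion_mk]
      have e : SemistableLocus.inclusion I ⟨_, w.property.restrict h0⟩ = w :=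
        SemistableLocus.ext (inclusion_restrict h0)
      rwa [e]
    · rintro ⟨h0, h⟩
      refine ⟨_, (hS' ⟨_, w.property.restrict h0⟩).mpr h, ?_⟩
      rw [inclusion_mk]
      exact congrArg _ (SemistableLocus.ext (inclusion_restrict h0))

/-! ### The pieces `𝓑_P` and the components of the fixed locus -/

theorem isClosed_componentAt {k : ℕ} {ι : Type*} (ρ : ι → Fin k → ℤ) (ξ : Fin k → ℤ) (R : ι → ℤ)
    (P : Fin k → ℂ) : IsClosed (componentAt ρ ξ R P) := by
  rw [componentAt, ← GITQuotient.range_inclusion]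
  exact (GITQuotient.isClosedEmbedding_inclusion ρ ξ _).isClosed_range

theorem isPreconnected_componentAt {k : ℕ} {ι : Type*} (ρ : ι → Fin k → ℤ) (ξ : Fin k → ℤ)
    (R : ι → ℤ) (P : Fin k → ℂ) : IsPreconnected (componentAt ρ ξ R P) := by
  rw [componentAt, ← GITQuotient.range_inclusion]
  exact isPreconnected_range (GITQuotient.isClosedEmbedding_inclusion ρ ξ _).continuous

theorem mk_mem_componentAt {k : ℕ} {ι : Type*} {ρ : ι → Fin k → ℤ} {ξ : Fin k → ℤ} {R : ι → ℤ}
    {P : Fin k → ℂ} {v : SemistableLocus ρ ξ} :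
    GITQuotient.mk v ∈ componentAt ρ ξ R P ↔ ∀ i, v.val i ≠ 0 → affineFun ρ R i P = 0 := by
  rw [componentAt, mk_mem_iInter_coordLocus]
  exact forall_congr' fun i => not_imp_comm

theorem mk_mem_fixedLocus {k : ℕ} {ι : Type*} {ρ : ι → Fin k → ℤ} {ξ : Fin k → ℤ} {R : ι → ℤ}
    {v : SemistableLocus ρ ξ} :
    GITQuotient.mk v ∈ fixedLocus ρ ξ R ↔ ∀ s, ∃ t, torusAct ρ t v.val = chargeAct R s v.val := by
  refine forall_congr' fun s => ?_
  rw [GITQuotient.act_mk, eq_comm, GITQuotient.mk_eq_mk]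

/-- `I_P` contains every `I` that cuts out `P`; enlarging `I` to `I_P` shrinks the intersection but
keeps `P` in it. -/
theorem iInter_indexSet_hyperplane {k : ℕ} {ι : Type*} {ρ : ι → Fin k → ℤ} {R : ι → ℤ}
    {P : Fin k → ℂ} (hP : P ∈ isolatedIntersections ρ R) :
    ⋂ i ∈ indexSet ρ R P, hyperplane ρ R i = {P} := by
  obtain ⟨I, hI⟩ := hP
  refine Set.Subset.antisymm ?_ ?_
  · rw [← hI]
    refine Set.biInter_subset_biInter_left fun i hi => ?_
    have : P ∈ ⋂ i ∈ I, hyperplane ρ R i := hI ▸ rfl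
    exact Set.mem_iInter₂.mp this i hi
  · rintro _ rfl
    exact Set.mem_iInter₂.mpr fun i hi => hi

/-- The support of a representative serves as the index set isolating `P`. -/
theorem exists_stableIntersection {k : ℕ} {ι : Type*} [Fintype ι] {ρ : ι → Fin k → ℤ}
    {ξ : Fin k → ℤ} (hξ : IsRegular ρ ξ) {R : ι → ℤ} {x : GITQuotient ρ ξ}
    (hx : x ∈ fixedLocus ρ ξ R) :
    ∃ P ∈ stableIntersections ρ ξ R, x ∈ componentAt ρ ξ R P := by
  obtain ⟨v, rfl⟩ := GITQuotient.mk_surjective x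
  obtain ⟨P, hP⟩ := exists_affineFun_eq_zero (mk_mem_fixedLocus.mp hx)
  refine ⟨P, ⟨⟨{i | v.val i ≠ 0}, Set.eq_singleton_iff_unique_mem.mpr
    ⟨Set.mem_iInter₂.mpr hP, fun Q hQ => ?_⟩⟩, v.property.mem_span hP⟩, mk_mem_componentAt.mpr hP⟩
  exact eq_of_affineFun_eq_zero hξ v.property (fun i hi => Set.mem_iInter₂.mp hQ i hi) hP

theorem componentAt_subset_fixedLocus {k : ℕ} {ι : Type*} {ρ : ι → Fin k → ℤ} {ξ : Fin k → ℤ}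
    {R : ι → ℤ} (P : Fin k → ℂ) : componentAt ρ ξ R P ⊆ fixedLocus ρ ξ R := by
  intro x hx
  obtain ⟨v, rfl⟩ := GITQuotient.mk_surjective x
  exact mk_mem_fixedLocus.mpr (exists_torusAct_eq_chargeAct (mk_mem_componentAt.mp hx))

theorem eq_of_mem_componentAt {k : ℕ} {ι : Type*} {ρ : ι → Fin k → ℤ} {ξ : Fin k → ℤ}
    (hξ : IsRegular ρ ξ) {R : ι → ℤ} {P Q : Fin k → ℂ} {x : GITQuotient ρ ξ}
    (hP : x ∈ componentAt ρ ξ R P) (hQ : x ∈ componentAt ρ ξ R Q) : P = Q := by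
  obtain ⟨v, rfl⟩ := GITQuotient.mk_surjective x
  exact eq_of_affineFun_eq_zero hξ v.property (mk_mem_componentAt.mp hP) (mk_mem_componentAt.mp hQ)

open Classical in
/-- `𝓑_P` contains a point all of whose coordinates in `I_P` are nonzero. -/
theorem exists_generic_mem_componentAt {k : ℕ} {ι : Type*} [Fintype ι] {ρ : ι → Fin k → ℤ}
    {ξ : Fin k → ℤ} {R : ι → ℤ} {P : Fin k → ℂ} (hP : P ∈ stableIntersections ρ ξ R) :
    ∃ v : SemistableLocus ρ ξ, GITQuotient.mk v ∈ componentAt ρ ξ R P ∧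
      ∀ i ∈ indexSet ρ R P, v.val i ≠ 0 := by
  have h1 : ∀ i ∈ indexSet ρ R P, (if i ∈ indexSet ρ R P then (1 : ℂ) else 0) ≠ 0 := by
    intro i hi
    simp [hi]
  refine ⟨⟨_, isSemistable_of_mem_span hP.2 h1⟩, mk_mem_componentAt.mpr fun i hi => ?_, h1⟩
  by_contra h
  exact hi (if_neg h)

/-- The generic point of `𝓑_P` lies in no `V(v_i)` with `i ∈ I_P`; the other `V(v_i)` contain `𝓑_P`
by construction. -/
theorem componentIndexSet_componentAt {k : ℕ} {ι : Type*} [Fintype ι] {ρ : ι → Fin k → ℤ}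
    {ξ : Fin k → ℤ} {R : ι → ℤ} {P : Fin k → ℂ} (hP : P ∈ stableIntersections ρ ξ R) :
    componentIndexSet ρ ξ (componentAt ρ ξ R P) = indexSet ρ R P := by
  obtain ⟨v, hv, hne⟩ := exists_generic_mem_componentAt hP
  ext i
  refine ⟨fun hi => ?_, fun hi h => hne i hi (mk_mem_coordLocus.mp (h hv))⟩
  by_contra h
  exact hi (Set.biInter_subset_of_mem h)

/-- `P` is recovered from `I_P`, and there are finitely many index sets. -/
theorem finite_stableIntersections {k : ℕ} {ι : Type*} [Finite ι] (ρ : ι → Fin k → ℤ)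
    (ξ : Fin k → ℤ) (R : ι → ℤ) : (stableIntersections ρ ξ R).Finite := by
  refine Set.Finite.of_injOn (f := indexSet ρ R) (t := Set.univ) (fun _ _ => trivial)
    (fun P hP Q hQ h => ?_) Set.finite_univ
  rw [← Set.singleton_eq_singleton_iff, ← iInter_indexSet_hyperplane hP.1,
    ← iInter_indexSet_hyperplane hQ.1, h]

theorem connectedComponentIn_fixedLocus {k : ℕ} {ι : Type*} [Fintype ι] {ρ : ι → Fin k → ℤ}
    {ξ : Fin k → ℤ} (hξ : IsRegular ρ ξ) {R : ι → ℤ} {P : Fin k → ℂ} {x : GITQuotient ρ ξ}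
    (hx : x ∈ componentAt ρ ξ R P) :
    connectedComponentIn (fixedLocus ρ ξ R) x = componentAt ρ ξ R P := by
  refine Set.Subset.antisymm ?_ ((isPreconnected_componentAt ρ ξ R P).subset_connectedComponentIn
    hx (componentAt_subset_fixedLocus P))
  have hxC : x ∈ connectedComponentIn (fixedLocus ρ ξ R) x :=
    mem_connectedComponentIn (componentAt_subset_fixedLocus P hx)
  have hclosed : IsClosed (⋃ Q ∈ stableIntersections ρ ξ R \ {P}, componentAt ρ ξ R Q) :=
    ((finite_stableIntersections ρ ξ R).subset Set.sdiff_subset).isClosed_biUnion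
      fun Q _ => isClosed_componentAt ρ ξ R Q
  have hcover : connectedComponentIn (fixedLocus ρ ξ R) x ⊆ componentAt ρ ξ R P ∪
      ⋃ Q ∈ stableIntersections ρ ξ R \ {P}, componentAt ρ ξ R Q := by
    intro y hy
    obtain ⟨Q, hQ, hyQ⟩ := exists_stableIntersection hξ (connectedComponentIn_subset _ _ hy)
    by_cases h : Q = P
    · exact .inl (h ▸ hyQ)
    · exact .inr (Set.mem_iUnion₂.mpr ⟨Q, ⟨hQ, h⟩, hyQ⟩)
  intro y hy
  rcases hcover hy with h | h
  · exact h
  -- A connected set meeting both closed parts of the cover would meet their intersection, but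
  -- distinct pieces are disjoint.
  obtain ⟨z, -, hzP, hz⟩ := isPreconnected_closed_iff.mp isPreconnected_connectedComponentIn _ _
    (isClosed_componentAt ρ ξ R P) hclosed hcover ⟨x, hxC, hx⟩ ⟨y, hy, h⟩
  obtain ⟨Q, hQ, hzQ⟩ := Set.mem_iUnion₂.mp hz
  exact absurd (eq_of_mem_componentAt hξ hzQ hzP) hQ.2

theorem componentAt_mem_fixedComponents {k : ℕ} {ι : Type*} [Fintype ι] {ρ : ι → Fin k → ℤ}
    {ξ : Fin k → ℤ} (hξ : IsRegular ρ ξ) {R : ι → ℤ} {P : Fin k → ℂ}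
    (hP : P ∈ stableIntersections ρ ξ R) : componentAt ρ ξ R P ∈ fixedComponents ρ ξ R := by
  obtain ⟨v, hv, -⟩ := exists_generic_mem_componentAt hP
  exact ⟨_, componentAt_subset_fixedLocus P hv, (connectedComponentIn_fixedLocus hξ hv).symm⟩

/-- The bijection `P ↦ 𝓑_P` from stable isolated intersections onto the components of the fixed
locus. -/
def stableIntersectionsEquiv {k : ℕ} {ι : Type*} [Fintype ι] {ρ : ι → Fin k → ℤ} {ξ : Fin k → ℤ}
    (hξ : IsRegular ρ ξ) (R : ι → ℤ) : stableIntersections ρ ξ R ≃ fixedComponents ρ ξ R :=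
  Equiv.ofBijective (fun P => ⟨componentAt ρ ξ R P.val, componentAt_mem_fixedComponents hξ P.2⟩) <| by
    constructor
    · rintro ⟨P, hP⟩ ⟨Q, hQ⟩ h
      obtain ⟨v, hv, -⟩ := exists_generic_mem_componentAt hP
      have h : componentAt ρ ξ R P = componentAt ρ ξ R Q := congrArg Subtype.val h
      exact Subtype.ext (eq_of_mem_componentAt hξ hv (h ▸ hv))
    · rintro ⟨_, x, hx, rfl⟩
      obtain ⟨P, hP, hxP⟩ := exists_stableIntersection hξ hx
      exact ⟨⟨P, hP⟩, Subtype.ext (connectedComponentIn_fixedLocus hξ hxP).symm⟩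

end TorusGIT

end

theorem mainTheorem3 {k N : ℕ} (ρ : Fin N → Fin k → ℤ) (ξ : Fin k → ℤ) (R : Fin N → ℤ)
    (hξ : TorusGIT.IsRegular ρ ξ) :
    (∀ P ∈ TorusGIT.stableIntersections ρ ξ R,
      ∃ h : TorusGIT.GITQuotient (TorusGIT.restrictWeights ρ (TorusGIT.indexSet ρ R P)) ξ ≃ₜ
          TorusGIT.componentAt ρ ξ R P,
        ∀ v, ∃ w : TorusGIT.SemistableLocus ρ ξ,
          w.val = TorusGIT.inclusion (TorusGIT.indexSet ρ R P) v.val ∧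
          (h (TorusGIT.GITQuotient.mk v)).val = TorusGIT.GITQuotient.mk w) ∧
    ∃ e : TorusGIT.stableIntersections ρ ξ R ≃ TorusGIT.fixedComponents ρ ξ R,
      (∀ P, (e P).val = TorusGIT.componentAt ρ ξ R P.val) ∧
      ∀ F, ⋂ i ∈ TorusGIT.componentIndexSet ρ ξ F.val, TorusGIT.hyperplane ρ R i =
        {(e.symm F).val} := by
  refine ⟨fun P _ => ?_, TorusGIT.stableIntersectionsEquiv hξ R, fun _ => rfl, fun F => ?_⟩
  · exact ⟨(TorusGIT.GITQuotient.isClosedEmbedding_inclusion ρ ξ _).isEmbedding.toHomeomorph.trans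
      (Homeomorph.setCongr (TorusGIT.GITQuotient.range_inclusion ρ ξ _)),
      fun v => ⟨TorusGIT.SemistableLocus.inclusion _ v, rfl, rfl⟩⟩
  · obtain ⟨P, rfl⟩ := (TorusGIT.stableIntersectionsEquiv hξ R).surjective F
    rw [Equiv.symm_apply_apply]
    change ⋂ i ∈ TorusGIT.componentIndexSet ρ ξ (TorusGIT.componentAt ρ ξ R P.val), _ = _
    rw [TorusGIT.componentIndexSet_componentAt P.2]
    exact TorusGIT.iInter_indexSet_hyperplane P.2.1
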